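/- Let $\alpha\in\mathbb{R}$ with $\alpha/\pi$ irrational, let $R_\alpha$ be the rotation of $\mathbb{R}^2$ by the angle $\alpha$, let $\overline e\in\mathbb{R}^2$ be a fixed unit vector, and let $\lambda>1$. Consider the iterated function system $\Phi_\lambda$ on $\mathbb{R}^2$ given by $$f_1(x)=(\lambda R_\alpha)^{-1}x,\qquad f_2(x)=x+\overline e,$$ the maps being chosen independently with probabilities $p_1=p_2=\tfrac12$. 1. For every $\lambda>1$ the system $\Phi_\lambda$ contracts on average, i.e. there is a constant $\chi<0$ such that, for almost every sequence $\omega\in\{1,2\}^{\mathbb N}$ with respect to the $(\tfrac12,\tfrac12)$ Bernoulli measure, $$\lim_{n\to\infty}\frac1n\log\|f_{\omega_0}\circ\dots\circ f_{\omega_{n-1}}\|=\chi,$$ where $\|g\|$ is the Lipschitz constant of $g$. There is a unique stationary Borel probability measure $\mu_\lambda$, i.e. a unique one with $\mu_\lambda=\tfrac12(f_1)_*\mu_\lambda+\tfrac12(f_2)_*\mu_\lambda$, and its support is full: $\operatorname{supp}(\mu_\lambda)=\mathbb{R}^2$. 2. If $\lambda>2$, then $\mu_\lambda$ is singular with respect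 to Lebesgue measure, and $$\dim_H(\mu_\lambda)\le\frac{2\log 2}{\log\lambda}<2,$$ where $\dim_H(\mu)$ is the infimum of the Hausdorff dimensions of the Borel sets of full $\mu$-measure. -/

import Mathlib

open MeasureTheory Filter Topology
open scoped NNReal ENNReal

noncomputable section

/-- The (least) Lipschitz constant of a map; it is `∞` if the map is not Lipschitz. -/
def lipConst {E : Type*} [PseudoEMetricSpace E] (g : E → E) : ℝ≥0∞ :=
  ⨅ (K : ℝ≥0) (_ : LipschitzWith K g), (K : ℝ≥0∞)

/-- The composition `f_{ω 0} ∘ f_{ω 1} ∘ ⋯ ∘ f_{ω (n - 1)}`. -/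
def ifsComp {ι E : Type*} (f : ι → E → E) (ω : ℕ → ι) : ℕ → E → E
  | 0 => id
  | n + 1 => ifsComp f ω n ∘ f (ω n)

/-- The Bernoulli (product) measure on `ι^ℕ` with marginals `p`. -/
def bernoulliSeq {ι : Type*} [MeasurableSpace ι] (p : PMF ι) : Measure (ℕ → ι) :=
  Measure.infinitePi fun _ : ℕ => p.toMeasure

/-- The IFS `f` with probabilities `p` contracts on average: the maps are Lipschitz and, almost
surely, `(1/n) log Lip(f_{ω 0} ∘ ⋯ ∘ f_{ω (n - 1)})` converges to a constant `χ < 0`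
(the Lyapunov exponent). The logarithm is extended-real-valued, with `log 0 = -∞`. -/
def ContractsOnAverage {ι E : Type*} [MeasurableSpace ι] [PseudoEMetricSpace E]
    (f : ι → E → E) (p : PMF ι) : Prop :=
  (∀ i, ∃ K : ℝ≥0, LipschitzWith K (f i)) ∧
    ∃ χ : ℝ, χ < 0 ∧ ∀ᵐ ω ∂(bernoulliSeq p),
      Tendsto (fun n : ℕ => ENNReal.log (lipConst (ifsComp f ω n)) / (n : EReal)) atTop
        (𝓝 (χ : EReal))

/-- `μ` is a stationary (invariant) probability measure of the IFS `f` with probabilities `p`: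
`μ = ∑ i, p i • (f i)_* μ`. -/
def IsStationaryMeasure {ι E : Type*} [Fintype ι] [MeasurableSpace E]
    (f : ι → E → E) (p : PMF ι) (μ : Measure E) : Prop :=
  IsProbabilityMeasure μ ∧ ∑ i, p i • μ.map (f i) = μ

/-- The Hausdorff dimension of a measure: the infimum of the Hausdorff dimensions of the
measurable sets of full measure. -/
def measureDimH {E : Type*} [EMetricSpace E] [MeasurableSpace E] (μ : Measure E) : ℝ≥0∞ :=
  ⨅ (S : Set E) (_ : MeasurableSet S) (_ : μ Sᶜ = 0), dimH S

/-- The matrix of the rotation of the plane by the angle `α`. -/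
def rotMatrix (α : ℝ) : Matrix (Fin 2) (Fin 2) ℝ :=
  !![Real.cos α, -Real.sin α; Real.sin α, Real.cos α]

/-- The planar IFS `f₁ x = (lam • R_α)⁻¹ x`, `f₂ x = x + e` (indexed by `0` and `1`). -/
def planarIFS (α lam : ℝ) (e : EuclideanSpace ℝ (Fin 2)) :
    Fin 2 → EuclideanSpace ℝ (Fin 2) → EuclideanSpace ℝ (Fin 2) :=
  ![fun x => Matrix.toEuclideanLin (lam • rotMatrix α)⁻¹ x, fun x => x + e]

end

/-! Both maps scale distances exactly, by `lam⁻¹` and by 1. Hence the Lipschitz constant of a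
composition is `lam⁻¹` to the number of zeros in the word, and the strong law of large numbers gives
the exponent `-(log lam) / 2`.

Stationarity is handled through characteristic functions, where it reads `2 φ(t) = φ(A* t) + φ(t)
exp(i⟨e, t⟩)`. Since `A*` contracts, two solutions agree (`markovOp_fixedPoint_unique`), and the
iterates from a point mass converge geometrically to a solution, which Lévy and Prokhorov turn into
a measure (`exists_markovOp_fixedPoint`).

The support is closed and invariant under both maps. In complex notation these are multiplication by
some `ρ` with `‖ρ‖ < 1` and translation by `ε`, so the support contains 0 and every `(∑ m_k ρ^k) ε`
with natural `m_k`. The irrationality of `α / π` makes `ρ` non-real, and then these points are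
dense.

For the dimension, a typical word of length `n` has about `n/2` zeros, so most of the mass lies in
`2^n` balls of radius about `lam^(-n/2)`. This gives dimension at most `2 log 2 / log lam`. For `lam
> 2` it is below 2, which forces singularity. -/

/-- The inverse of a scaled rotation matrix acts as a complex multiplication. -/
theorem toEuclideanLin_smul_rotMatrix_inv (α lam : ℝ) (hlam : lam ≠ 0) (z : ℂ) :
    Matrix.toEuclideanLin (lam • rotMatrix α)⁻¹ (Complex.orthonormalBasisOneI.repr z) =
      Complex.orthonormalBasisOneI.repr ((lam : ℂ)⁻¹ * Complex.exp (-(α * Complex.I)) * z) := by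
  have hinv : (lam • rotMatrix α)⁻¹ = lam⁻¹ • rotMatrix (-α) := by
    apply Matrix.inv_eq_right_inv
    rw [Matrix.smul_mul, Matrix.mul_smul, smul_smul, mul_inv_cancel₀ hlam, one_smul]
    have h := Real.sin_sq_add_cos_sq α
    ext i j
    fin_cases i <;> fin_cases j <;> simp [rotMatrix, Matrix.mul_apply, Fin.sum_univ_two] <;>
      nlinarith
  have hexp : Complex.exp (-(α * Complex.I)) = ⟨Real.cos α, -Real.sin α⟩ := by
    have : (-(α * Complex.I)) = ((-α : ℝ) : ℂ) * Complex.I := by push_cast; ring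
    rw [this]
    apply Complex.ext
    · rw [Complex.exp_ofReal_mul_I_re, Real.cos_neg]
    · rw [Complex.exp_ofReal_mul_I_im, Real.sin_neg]
  rw [hinv, hexp, ← Complex.ofReal_inv]
  ext i
  fin_cases i <;>
    simp [Matrix.toLpLin_apply, rotMatrix] <;> ring

theorem norm_toEuclideanLin_smul_rotMatrix_inv (α lam : ℝ) (hlam : 0 < lam)
    (x : EuclideanSpace ℝ (Fin 2)) :
    ‖Matrix.toEuclideanLin (lam • rotMatrix α)⁻¹ x‖ = lam⁻¹ * ‖x‖ := by
  obtain ⟨z, rfl⟩ := Complex.orthonormalBasisOneI.repr.surjective x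
  rw [toEuclideanLin_smul_rotMatrix_inv α lam hlam.ne', LinearIsometryEquiv.norm_map,
    LinearIsometryEquiv.norm_map, norm_mul, norm_mul, norm_inv, Complex.norm_real,
    Real.norm_of_nonneg hlam.le]
  have : ‖Complex.exp (-(α * Complex.I))‖ = 1 := by
    simpa using Complex.norm_exp_ofReal_mul_I (-α)
  rw [this, mul_one]

/-- The multiplier of a scaled irrational rotation is not real. -/
theorem im_inv_mul_exp_neg_ne_zero (α lam : ℝ) (hα : Irrational (α / Real.pi)) (hlam : lam ≠ 0) :
    ((lam : ℂ)⁻¹ * Complex.exp (-(α * Complex.I))).im ≠ 0 := by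
  have : (-(α * Complex.I)) = ((-α : ℝ) : ℂ) * Complex.I := by push_cast; ring
  rw [this, ← Complex.ofReal_inv, Complex.im_ofReal_mul, Complex.exp_ofReal_mul_I_im, Real.sin_neg]
  refine mul_ne_zero (inv_ne_zero hlam) (neg_ne_zero.2 fun h => ?_)
  obtain ⟨n, hn⟩ := Real.sin_eq_zero_iff.1 h
  exact hα ⟨n, by rw [← hn]; field_simp; push_cast; ring⟩

/-! ### Contraction on average -/

theorem lipConst_eq_of_dist_eq {E : Type*} [NormedAddCommGroup E] [Nontrivial E] {g : E → E}
    {c : ℝ≥0} (h : ∀ x y, dist (g x) (g y) = c * dist x y) : lipConst g = c := by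
  have hg : LipschitzWith c g := LipschitzWith.of_dist_le_mul fun x y => (h x y).le
  refine le_antisymm (iInf₂_le c hg) (le_iInf₂ fun K hK => ?_)
  obtain ⟨x, y, hxy⟩ := exists_pair_ne E
  have h1 := hK.dist_le_mul x y
  rw [h] at h1
  exact_mod_cast le_of_mul_le_mul_right h1 (dist_pos.2 hxy)

/-- The indicator of the symbol `0`. -/
def zeroIndicator (i : Fin 2) : ℕ := if i = 0 then 1 else 0

theorem dist_ifsComp {E : Type*} [PseudoMetricSpace E] {f : Fin 2 → E → E} {r : ℝ≥0}
    (hf : ∀ i x y, dist (f i x) (f i y) = (r : ℝ) ^ zeroIndicator i * dist x y)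
    (ω : ℕ → Fin 2) (n : ℕ) (x y : E) :
    dist (ifsComp f ω n x) (ifsComp f ω n y) =
      (r : ℝ) ^ (∑ k ∈ Finset.range n, zeroIndicator (ω k)) * dist x y := by
  induction n generalizing x y with
  | zero => simp [ifsComp]
  | succ n ih =>
    rw [ifsComp, Function.comp_apply, Function.comp_apply, ih, hf, Finset.sum_range_succ, pow_add,
      mul_assoc]

instance : IsProbabilityMeasure (bernoulliSeq (PMF.uniformOfFintype (Fin 2))) := by
  unfold bernoulliSeq; infer_instance

/-- In a fair Bernoulli sequence the frequency of the symbol `0` is almost surely one half. -/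
theorem ae_tendsto_frequency_zero :
    ∀ᵐ ω ∂(bernoulliSeq (PMF.uniformOfFintype (Fin 2))),
      Tendsto (fun n : ℕ => (∑ k ∈ Finset.range n, (zeroIndicator (ω k) : ℝ)) / n) atTop
        (𝓝 (1 / 2)) := by
  have hmap : ∀ i : ℕ, Measure.map (fun ω : ℕ → Fin 2 => ω i)
      (bernoulliSeq (PMF.uniformOfFintype (Fin 2))) =
      (PMF.uniformOfFintype (Fin 2)).toMeasure := fun i =>
    Measure.infinitePi_map_eval (μ := fun _ : ℕ => (PMF.uniformOfFintype (Fin 2)).toMeasure) i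
  have hX : Measurable (fun i : Fin 2 => (zeroIndicator i : ℝ)) := measurable_of_finite _
  have hind := ProbabilityTheory.iIndepFun_infinitePi
    (P := fun _ : ℕ => (PMF.uniformOfFintype (Fin 2)).toMeasure)
    (X := fun _ (i : Fin 2) => (zeroIndicator i : ℝ)) (fun _ => hX)
  have hbdd : ∀ i : Fin 2, ‖(zeroIndicator i : ℝ)‖ ≤ 1 := by
    intro i; fin_cases i <;> simp [zeroIndicator]
  have hlaw := ProbabilityTheory.strong_law_ae_real
    (μ := bernoulliSeq (PMF.uniformOfFintype (Fin 2)))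
    (fun i (ω : ℕ → Fin 2) => (zeroIndicator (ω i) : ℝ))
    (Integrable.of_bound (hX.comp (measurable_pi_apply 0)).aestronglyMeasurable 1
      (Eventually.of_forall fun ω => hbdd _))
    (fun i j hij => hind.indepFun hij)
    (fun i => ⟨(hX.comp (measurable_pi_apply i)).aemeasurable,
      (hX.comp (measurable_pi_apply 0)).aemeasurable, by
        have h : ∀ j : ℕ, Measure.map (fun ω : ℕ → Fin 2 => (zeroIndicator (ω j) : ℝ))
            (bernoulliSeq (PMF.uniformOfFintype (Fin 2))) =
            Measure.map (fun i : Fin 2 => (zeroIndicator i : ℝ))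
              (PMF.uniformOfFintype (Fin 2)).toMeasure := fun j => by
          rw [← hmap j, Measure.map_map hX (measurable_pi_apply j)]; rfl
        rw [h i, h 0]⟩)
  have hmean : ∫ ω, (zeroIndicator (ω 0) : ℝ) ∂(bernoulliSeq (PMF.uniformOfFintype (Fin 2))) =
      1 / 2 := by
    rw [← integral_map (φ := fun ω : ℕ → Fin 2 => ω 0) (measurable_pi_apply 0).aemeasurable
      hX.aestronglyMeasurable, hmap, PMF.integral_eq_sum]
    simp [zeroIndicator]
  rwa [hmean] at hlaw

/-- The logarithm of the Lipschitz constant is exactly the number of zeros times `log r`, so only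
the limiting frequency of zeros matters. -/
theorem contractsOnAverage_of_dist_eq {E : Type*} [NormedAddCommGroup E] [Nontrivial E]
    {f : Fin 2 → E → E} {r : ℝ≥0} (hr0 : 0 < r) (hr1 : r < 1)
    (hf : ∀ i x y, dist (f i x) (f i y) = (r : ℝ) ^ zeroIndicator i * dist x y) :
    ContractsOnAverage f (PMF.uniformOfFintype (Fin 2)) := by
  refine ⟨fun i => ⟨r ^ zeroIndicator i, LipschitzWith.of_dist_le_mul fun x y => ?_⟩,
    1 / 2 * Real.log r, ?_, ?_⟩
  · rw [hf]; push_cast; rfl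
  · have := Real.log_neg (x := r) (by exact_mod_cast hr0) (by exact_mod_cast hr1)
    linarith
  · filter_upwards [ae_tendsto_frequency_zero] with ω hω
    have hlim := (continuous_coe_real_ereal.tendsto _).comp (hω.mul_const (Real.log r))
    refine hlim.congr fun n => ?_
    have hlip : lipConst (ifsComp f ω n) =
        ((r ^ (∑ k ∈ Finset.range n, zeroIndicator (ω k)) : ℝ≥0) : ℝ≥0∞) :=
      lipConst_eq_of_dist_eq fun x y => by rw [dist_ifsComp hf]; push_cast; rfl
    rw [hlip, ← ENNReal.ofReal_coe_nnreal, ENNReal.log_ofReal_of_pos (by positivity)]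
    rw [Function.comp_apply, ← EReal.coe_natCast, ← EReal.coe_div]
    rw [NNReal.coe_pow, Real.log_pow, Nat.cast_sum, div_mul_eq_mul_div]

/-! ### Existence and uniqueness of the stationary measure -/

section MarkovOperator

variable {E : Type*} [NormedAddCommGroup E] [InnerProductSpace ℝ E]

theorem norm_exp_inner_mul_I_sub_one_le (e t : E) :
    ‖Complex.exp (inner ℝ e t * Complex.I) - 1‖ ≤ ‖e‖ * ‖t‖ := by
  have h := Real.norm_exp_I_mul_ofReal_sub_one_le (x := inner ℝ e t)
  rw [mul_comm] at h
  exact h.trans (abs_real_inner_le_norm e t)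

variable [FiniteDimensional ℝ E] {A : E →L[ℝ] E} {r : ℝ}

theorem norm_adjoint_apply_le (hA : ∀ x, ‖A x‖ ≤ r * ‖x‖) (hr : 0 ≤ r) (t : E) :
    ‖A.adjoint t‖ ≤ r * ‖t‖ := by
  refine (A.adjoint.le_opNorm t).trans ?_
  rw [LinearIsometryEquiv.norm_map]
  gcongr
  exact A.opNorm_le_bound hr hA

theorem norm_adjoint_pow_apply_le (hA : ∀ x, ‖A x‖ ≤ r * ‖x‖) (hr : 0 ≤ r) (t : E) (n : ℕ) :
    ‖(A.adjoint)^[n] t‖ ≤ r ^ n * ‖t‖ := by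
  induction n with
  | zero => simp
  | succ n ih =>
    rw [Function.iterate_succ_apply', pow_succ', mul_assoc]
    exact (norm_adjoint_apply_le hA hr _).trans (by gcongr)

variable [MeasurableSpace E] [BorelSpace E]

/-- The Markov operator on measures of the random system `x ↦ A x`, `x ↦ x + e`, both with
probability one half. -/
noncomputable def markovOp (A : E →L[ℝ] E) (e : E) (μ : Measure E) : Measure E :=
  (2⁻¹ : ℝ≥0∞) • μ.map A + (2⁻¹ : ℝ≥0∞) • μ.map (fun x => x + e)

instance isProbabilityMeasure_markovOp (A : E →L[ℝ] E) (e : E) (μ : Measure E)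
    [IsProbabilityMeasure μ] : IsProbabilityMeasure (markovOp A e μ) := by
  have h1 : IsProbabilityMeasure (μ.map A) :=
    Measure.isProbabilityMeasure_map A.continuous.aemeasurable
  have h2 : IsProbabilityMeasure (μ.map (fun x => x + e)) :=
    Measure.isProbabilityMeasure_map (continuous_add_const e).aemeasurable
  refine ⟨?_⟩
  simp [markovOp, ENNReal.inv_two_add_inv_two]

theorem charFun_map_continuousLinearMap (A : E →L[ℝ] E) (μ : Measure E) (t : E) :
    charFun (μ.map A) t = charFun μ (A.adjoint t) := by
  rw [charFun_apply, charFun_apply, integral_map A.continuous.aemeasurable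
    (by fun_prop)]
  simp_rw [ContinuousLinearMap.adjoint_inner_right]

theorem charFun_markovOp (A : E →L[ℝ] E) (e : E) (μ : Measure E) [IsProbabilityMeasure μ] (t : E) :
    charFun (markovOp A e μ) t =
      2⁻¹ * charFun μ (A.adjoint t) +
        2⁻¹ * (charFun μ t * Complex.exp (inner ℝ e t * Complex.I)) := by
  have h1 : IsProbabilityMeasure (μ.map A) :=
    Measure.isProbabilityMeasure_map A.continuous.aemeasurable
  have h2 : IsProbabilityMeasure (μ.map (fun x => x + e)) :=
    Measure.isProbabilityMeasure_map (continuous_add_const e).aemeasurable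
  have hint : ∀ ν : Measure E, IsProbabilityMeasure ν →
      Integrable (fun x => Complex.exp (inner ℝ x t * Complex.I)) ((2⁻¹ : ℝ≥0∞) • ν) := by
    intro ν hν
    refine Integrable.smul_measure (Integrable.of_bound (C := 1) (by fun_prop) ?_) (by simp)
    exact Eventually.of_forall fun x => (Complex.norm_exp_ofReal_mul_I _).le
  rw [markovOp, charFun_apply, integral_add_measure (hint _ h1) (hint _ h2), integral_smul_measure,
    integral_smul_measure, ← charFun_apply, ← charFun_apply, charFun_map_continuousLinearMap,
    charFun_map_add_const]
  simp

/-- Since `|2 - exp(iθ)| ≥ 1`, the difference of the characteristic functions at `t` is at most that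
at `A* t`. Iterating moves the argument to 0, where both equal 1. -/
theorem markovOp_fixedPoint_unique (hA : ∀ x, ‖A x‖ ≤ r * ‖x‖) (hr0 : 0 ≤ r) (hr1 : r < 1) (e : E)
    {μ ν : Measure E} [IsProbabilityMeasure μ] [IsProbabilityMeasure ν]
    (hμ : markovOp A e μ = μ) (hν : markovOp A e ν = ν) : μ = ν := by
  have key : ∀ t, ‖charFun μ t - charFun ν t‖ ≤
      ‖charFun μ (A.adjoint t) - charFun ν (A.adjoint t)‖ := by
    intro t
    have h1 := charFun_markovOp A e μ t
    have h2 := charFun_markovOp A e ν t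
    rw [hμ] at h1
    rw [hν] at h2
    set a := charFun μ t - charFun ν t with ha
    set b := charFun μ (A.adjoint t) - charFun ν (A.adjoint t) with hb
    have h3 : 2 * a = b + a * Complex.exp (inner ℝ e t * Complex.I) := by
      rw [ha, hb]; linear_combination 2 * h1 - 2 * h2
    have h4 : 2 * ‖a‖ ≤ ‖b‖ + ‖a‖ := by
      calc 2 * ‖a‖ = ‖2 * a‖ := by rw [norm_mul]; norm_num
        _ ≤ ‖b‖ + ‖a * Complex.exp (inner ℝ e t * Complex.I)‖ := by rw [h3]; exact norm_add_le _ _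
        _ = ‖b‖ + ‖a‖ := by rw [norm_mul, Complex.norm_exp_ofReal_mul_I, mul_one]
    linarith
  refine Measure.ext_of_charFun (funext fun t => ?_)
  have hit : ∀ n : ℕ, ‖charFun μ t - charFun ν t‖ ≤
      ‖charFun μ ((A.adjoint)^[n] t) - charFun ν ((A.adjoint)^[n] t)‖ := by
    intro n
    induction n with
    | zero => simp
    | succ n ih => rw [Function.iterate_succ_apply']; exact ih.trans (key _)
  have hzero : Tendsto (fun n : ℕ => (A.adjoint)^[n] t) atTop (𝓝 0) := by
    refine squeeze_zero_norm (norm_adjoint_pow_apply_le hA hr0 t) ?_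
    simpa using (tendsto_pow_atTop_nhds_zero_of_lt_one hr0 hr1).mul_const ‖t‖
  have hcμ : Continuous (charFun μ) := continuous_charFun
  have hcν : Continuous (charFun ν) := continuous_charFun
  have hlim := (((hcμ.sub hcν).norm).tendsto 0).comp hzero
  simp only [Function.comp_def, Pi.sub_apply, charFun_zero, probReal_univ, sub_self,
    norm_zero] at hlim
  have := ge_of_tendsto' hlim hit
  exact sub_eq_zero.1 (norm_le_zero_iff.1 this)

theorem exists_markovOp_fixedPoint (hA : ∀ x, ‖A x‖ ≤ r * ‖x‖) (hr0 : 0 ≤ r) (hr1 : r < 1) (e : E) :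
    ∃ μ : Measure E, IsProbabilityMeasure μ ∧ markovOp A e μ = μ := by
  let m : ℕ → Measure E := fun n => (markovOp A e)^[n] (Measure.dirac 0)
  have hsucc : ∀ n, m (n + 1) = markovOp A e (m n) := fun n => Function.iterate_succ_apply' ..
  have hm : ∀ n, IsProbabilityMeasure (m n) := by
    intro n
    induction n with
    | zero => exact Measure.dirac.isProbabilityMeasure
    | succ n ih => rw [hsucc]; infer_instance
  -- A bound `C ‖t‖` on a difference of characteristic functions improves to `q C ‖t‖`: the linear
  -- half contributes `r/2`, the translation half `1/2`.
  set q : ℝ := (1 + r) / 2 with hq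
  have hq0 : 0 ≤ q := by positivity
  have hq1 : q < 1 := by linarith
  have hstep : ∀ n t, dist (charFun (m n) t) (charFun (m (n + 1)) t) ≤
      2⁻¹ * ‖e‖ * ‖t‖ * q ^ n := by
    intro n
    induction n with
    | zero =>
      intro t
      rw [hsucc, charFun_markovOp, dist_comm, dist_eq_norm]
      have : m 0 = Measure.dirac 0 := rfl
      rw [this, charFun_dirac, charFun_dirac]
      have h : ∀ z : ℂ, 2⁻¹ * Complex.exp ((inner ℝ (0 : E) (A.adjoint t) : ℝ) * Complex.I) +
          2⁻¹ * (Complex.exp ((inner ℝ (0 : E) t : ℝ) * Complex.I) * z) -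
          Complex.exp ((inner ℝ (0 : E) t : ℝ) * Complex.I) = 2⁻¹ * (z - 1) := by
        intro z; simp; ring
      rw [h, norm_mul, norm_inv, Complex.norm_ofNat, pow_zero, mul_one, mul_assoc]
      gcongr
      exact norm_exp_inner_mul_I_sub_one_le e t
    | succ n ih =>
      intro t
      rw [hsucc (n + 1), charFun_markovOp]
      nth_rw 1 [hsucc n]
      rw [charFun_markovOp, dist_eq_norm]
      have h1 := ih t
      have h2 := ih (A.adjoint t)
      rw [dist_eq_norm] at h1 h2
      have h3 := norm_adjoint_apply_le hA hr0 t
      calc _ = ‖2⁻¹ * (charFun (m n) (A.adjoint t) - charFun (m (n + 1)) (A.adjoint t)) +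
            2⁻¹ * ((charFun (m n) t - charFun (m (n + 1)) t) *
              Complex.exp (inner ℝ e t * Complex.I))‖ := by congr 1; ring
        _ ≤ 2⁻¹ * ‖charFun (m n) (A.adjoint t) - charFun (m (n + 1)) (A.adjoint t)‖ +
            2⁻¹ * ‖charFun (m n) t - charFun (m (n + 1)) t‖ := by
          refine (norm_add_le _ _).trans (le_of_eq ?_)
          rw [norm_mul, norm_mul, norm_mul, Complex.norm_exp_ofReal_mul_I, norm_inv,
            Complex.norm_ofNat, mul_one]
        _ ≤ 2⁻¹ * (2⁻¹ * ‖e‖ * (r * ‖t‖) * q ^ n) + 2⁻¹ * (2⁻¹ * ‖e‖ * ‖t‖ * q ^ n) := by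
          gcongr
          exact h2.trans (by gcongr)
        _ = 2⁻¹ * ‖e‖ * ‖t‖ * q ^ (n + 1) := by rw [pow_succ, hq]; ring
  have hconv : ∀ t, ∃ z, Tendsto (fun n => charFun (m n) t) atTop (𝓝 z) := fun t =>
    cauchySeq_tendsto_of_complete (cauchySeq_of_le_geometric q _ hq1 fun n => hstep n t)
  choose φ hφ using hconv
  have hφ0 : φ 0 = 1 := tendsto_nhds_unique (hφ 0) (by simp)
  -- Continuity of the limit at 0 is Lévy's criterion for tightness; summing the geometric steps
  -- gives it.
  have hcont : ContinuousAt φ 0 := by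
    rw [ContinuousAt, hφ0, tendsto_iff_dist_tendsto_zero]
    have hb : ∀ t, dist (φ t) 1 ≤ 2⁻¹ * ‖e‖ * ‖t‖ / (1 - q) := by
      intro t
      have := dist_le_of_le_geometric_of_tendsto₀ q _ hq1 (fun n => hstep n t) (hφ t)
      have h0 : charFun (m 0) t = 1 := by
        have : m 0 = Measure.dirac 0 := rfl
        rw [this, charFun_dirac]; simp
      rw [h0, dist_comm] at this
      exact this
    refine squeeze_zero (fun _ => dist_nonneg) hb ?_
    have : Continuous fun t : E => 2⁻¹ * ‖e‖ * ‖t‖ / (1 - q) := by fun_prop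
    simpa using this.tendsto 0
  have htight := isTightMeasureSet_of_tendsto_charFun hcont hφ
  let P : ℕ → ProbabilityMeasure E := fun n => ⟨m n, hm n⟩
  have hcompact : IsCompact (closure (Set.range P)) := by
    refine isCompact_closure_of_isTightMeasureSet (htight.subset ?_)
    rintro _ ⟨_, ⟨n, rfl⟩, rfl⟩
    exact ⟨n, rfl⟩
  -- Any limit point will do, since the characteristic functions already converge along the full
  -- sequence.
  let U : Ultrafilter ℕ := Ultrafilter.of atTop
  obtain ⟨ν, -, hν⟩ := hcompact.ultrafilter_le_nhds (U.map P) (by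
    rw [le_principal_iff]
    exact Filter.mem_of_superset (Filter.image_mem_map Filter.univ_mem)
      (by rw [Set.image_univ]; exact subset_closure))
  have hνt : Tendsto P U (𝓝 ν) := hν
  have hνφ : ∀ t, charFun (ν : Measure E) t = φ t := by
    intro t
    rw [ProbabilityMeasure.tendsto_iff_forall_integral_rclike_tendsto ℂ] at hνt
    have h := hνt (BoundedContinuousFunction.innerProbChar t)
    simp_rw [← charFun_eq_integral_innerProbChar] at h
    exact tendsto_nhds_unique h ((hφ t).mono_left (Ultrafilter.of_le atTop))
  refine ⟨ν, inferInstance, Measure.ext_of_charFun (funext fun t => ?_)⟩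
  rw [charFun_markovOp, hνφ, hνφ]
  have h1 := (tendsto_add_atTop_iff_nat 1).2 (hφ t)
  simp_rw [hsucc, charFun_markovOp] at h1
  exact tendsto_nhds_unique
    (((hφ _).const_mul _).add (((hφ t).mul_const _).const_mul _)) h1

end MarkovOperator

/-! ### Full support -/

theorem tendsto_inv_mul_geom_sum_zero {v : ℂ} (hv : ‖v‖ = 1) (hv1 : v ≠ 1) (a : ℂ) :
    Tendsto (fun n : ℕ => (n : ℂ)⁻¹ * (a * ∑ j ∈ Finset.range n, v ^ j)) atTop (𝓝 0) := by
  have hb : ∀ n : ℕ, ‖a * ∑ j ∈ Finset.range n, v ^ j‖ ≤ ‖a‖ * (2 / ‖v - 1‖) := by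
    intro n
    rw [norm_mul, geom_sum_eq hv1, norm_div]
    gcongr
    calc ‖v ^ n - 1‖ ≤ ‖v ^ n‖ + ‖(1 : ℂ)‖ := norm_sub_le _ _
      _ = 2 := by rw [norm_pow, hv]; norm_num
  refine squeeze_zero_norm (a := fun n : ℕ => (n : ℝ)⁻¹ * (‖a‖ * (2 / ‖v - 1‖))) (fun n => ?_) ?_
  · rw [norm_mul, norm_inv, Complex.norm_natCast]
    gcongr
    exact hb n
  · simpa using (tendsto_inv_atTop_nhds_zero_nat (𝕜 := ℝ)).mul_const (‖a‖ * (2 / ‖v - 1‖))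

/-- Powers of a non-real unit complex number positively span the plane, with averaged weights. -/
theorem tendsto_sum_weights_mul_pow {u : ℂ} (hu : ‖u‖ = 1) (him : u.im ≠ 0) (w : ℂ) (K : ℕ) :
    Tendsto (fun n : ℕ => ∑ j ∈ Finset.range n,
      (((2 / n * (‖w‖ + (starRingEnd ℂ w * u ^ (K + j)).re) : ℝ)) : ℂ) * u ^ (K + j))
      atTop (𝓝 w) := by
  have hu1 : u ≠ 1 := by rintro rfl; simp at him
  have hu2 : u ^ 2 ≠ 1 := by
    intro h
    rw [sq, mul_self_eq_one_iff] at h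
    rcases h with h | h <;> simp [h] at him
  have hmul : ∀ k : ℕ, u ^ k * starRingEnd ℂ (u ^ k) = 1 := by
    intro k
    rw [Complex.mul_conj, Complex.normSq_eq_norm_sq, norm_pow, hu]; simp
  have h1 := tendsto_inv_mul_geom_sum_zero hu hu1 (2 * ‖w‖ * u ^ K)
  have h2 := tendsto_inv_mul_geom_sum_zero (v := u ^ 2) (by rw [norm_pow, hu, one_pow]) hu2
    (starRingEnd ℂ w * u ^ (2 * K))
  have h3 := (h1.add h2).const_add w
  rw [add_zero, add_zero] at h3
  refine h3.congr' ?_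
  filter_upwards [eventually_gt_atTop 0] with n hn
  have hn' : (n : ℂ) ≠ 0 := by exact_mod_cast hn.ne'
  -- Each summand splits into a constant part, which averages to `w`, and multiples of powers of `u`
  -- and of `u ^ 2`. The latter average to 0 because `u ≠ 1` and `u ^ 2 ≠ 1`.
  have hterm : ∀ j : ℕ,
      (((2 / n * (‖w‖ + (starRingEnd ℂ w * u ^ (K + j)).re) : ℝ)) : ℂ) * u ^ (K + j) =
      (n : ℂ)⁻¹ * (2 * ‖w‖ * u ^ K * u ^ j + starRingEnd ℂ w * u ^ (2 * K) * (u ^ 2) ^ j + w) := by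
    intro j
    have hre : (((starRingEnd ℂ w * u ^ (K + j)).re : ℝ) : ℂ) =
        (starRingEnd ℂ w * u ^ (K + j) + w * starRingEnd ℂ (u ^ (K + j))) / 2 := by
      rw [Complex.re_eq_add_conj, map_mul, Complex.conj_conj]
    push_cast
    rw [hre]
    have h := hmul (K + j)
    field_simp
    linear_combination w * h
  rw [Finset.sum_congr rfl fun j _ => hterm j, ← Finset.mul_sum, Finset.sum_add_distrib,
    Finset.sum_add_distrib, ← Finset.mul_sum, ← Finset.mul_sum, Finset.sum_const,
    Finset.card_range, nsmul_eq_mul]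
  field_simp
  ring

/-- A nonempty closed subset of the plane that is invariant under a non-real contracting
multiplication and a nontrivial translation is the whole plane. -/
theorem IsClosed.eq_univ_of_mul_mem_of_add_mem {T : Set ℂ} (hT : IsClosed T) (hne : T.Nonempty)
    {ρ ε : ℂ} (hρ : ‖ρ‖ < 1) (him : ρ.im ≠ 0) (hε : ε ≠ 0)
    (hmul : ∀ z ∈ T, ρ * z ∈ T) (hadd : ∀ z ∈ T, z + ε ∈ T) : T = Set.univ := by
  have h0 : (0 : ℂ) ∈ T := by
    obtain ⟨x, hx⟩ := hne
    have hmem : ∀ n : ℕ, ρ ^ n * x ∈ T := by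
      intro n
      induction n with
      | zero => simpa using hx
      | succ n ih => rw [pow_succ', mul_assoc]; exact hmul _ ih
    have hlim : Tendsto (fun n : ℕ => ρ ^ n * x) atTop (𝓝 0) := by
      simpa using (tendsto_pow_atTop_nhds_zero_of_norm_lt_one hρ).mul_const x
    exact hT.mem_of_tendsto hlim (Eventually.of_forall hmem)
  have hnat : ∀ (m : ℕ), ∀ z ∈ T, z + m * ε ∈ T := by
    intro m z hz
    induction m with
    | zero => simpa using hz
    | succ m ih => convert hadd _ ih using 1; push_cast; ring
  -- Horner's scheme: multiply by `ρ`, then translate `m 0` times.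
  have hcomb : ∀ (n : ℕ) (m : ℕ → ℕ), (∑ k ∈ Finset.range n, (m k : ℂ) * ρ ^ k) * ε ∈ T := by
    intro n
    induction n with
    | zero => intro m; simpa using h0
    | succ n ih =>
      intro m
      have h := hnat (m 0) _ (hmul _ (ih fun k => m (k + 1)))
      convert h using 1
      rw [Finset.sum_range_succ', add_mul, ← mul_assoc, Finset.mul_sum]
      congr 2
      · exact Finset.sum_congr rfl fun k _ => by ring
      · simp
  have hρ0 : ρ ≠ 0 := by rintro rfl; simp at him
  have hr0 : 0 < ‖ρ‖ := norm_pos_iff.2 hρ0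
  have hr0' : (‖ρ‖ : ℂ) ≠ 0 := by exact_mod_cast hr0.ne'
  set u : ℂ := ((‖ρ‖⁻¹ : ℝ) : ℂ) * ρ with hu
  have hu1 : ‖u‖ = 1 := by
    rw [hu, norm_mul, Complex.norm_real, norm_inv, norm_norm, inv_mul_cancel₀ hr0.ne']
  have huim : u.im ≠ 0 := by
    rw [hu, Complex.im_ofReal_mul]; exact mul_ne_zero (inv_ne_zero hr0.ne') him
  have hρu : ρ = ‖ρ‖ * u := by rw [hu]; push_cast; field_simp
  refine Set.eq_univ_of_forall fun z => ?_
  rw [← hT.closure_eq, Metric.mem_closure_iff]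
  intro δ hδ
  set w := z / ε with hw
  have hzw : z = w * ε := by rw [hw]; field_simp
  have hεn : 0 < ‖ε‖ := norm_pos_iff.2 hε
  -- Rounding real coefficients of `ρ ^ k`, `k ≥ K`, down to integers costs at most this geometric
  -- tail, so only high powers are used.
  obtain ⟨K, hK⟩ : ∃ K : ℕ, ‖ρ‖ ^ K * (1 - ‖ρ‖)⁻¹ < δ / ‖ε‖ / 2 := by
    have : Tendsto (fun K : ℕ => ‖ρ‖ ^ K * (1 - ‖ρ‖)⁻¹) atTop (𝓝 0) := by
      simpa using (tendsto_pow_atTop_nhds_zero_of_lt_one hr0.le hρ).mul_const (1 - ‖ρ‖)⁻¹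
    exact (this.eventually_lt_const (by positivity)).exists
  obtain ⟨n, hn⟩ := (Metric.tendsto_nhds.1 (tendsto_sum_weights_mul_pow hu1 huim w K)
    (δ / ‖ε‖ / 2) (by positivity)).exists
  let c : ℕ → ℝ := fun j => 2 / n * (‖w‖ + (starRingEnd ℂ w * u ^ (K + j)).re)
  have hc : ∀ j, 0 ≤ c j := by
    intro j
    have h1 := Complex.abs_re_le_norm (starRingEnd ℂ w * u ^ (K + j))
    rw [norm_mul, norm_pow, hu1, one_pow, mul_one, Complex.norm_conj] at h1
    have h2 := (abs_le.1 h1).1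
    have : 0 ≤ ‖w‖ + (starRingEnd ℂ w * u ^ (K + j)).re := by linarith
    positivity
  -- Rescaled so that `c j * u ^ (K + j) = d j * ρ ^ (K + j)`. The weights must be nonnegative for
  -- their floors to count translations.
  let d : ℕ → ℝ := fun j => c j / ‖ρ‖ ^ (K + j)
  have hd : ∀ j, 0 ≤ d j := fun j => div_nonneg (hc j) (by positivity)
  let m : ℕ → ℕ := fun k => if K ≤ k then ⌊d (k - K)⌋₊ else 0
  have hsum : ∑ k ∈ Finset.range (K + n), (m k : ℂ) * ρ ^ k =
      ∑ j ∈ Finset.range n, (⌊d j⌋₊ : ℂ) * ρ ^ (K + j) := by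
    rw [Finset.sum_range_add, Finset.sum_eq_zero, zero_add]
    · exact Finset.sum_congr rfl fun j _ => by simp [m]
    · intro k hk
      simp [m, not_le.2 (Finset.mem_range.1 hk)]
  have hfl : ‖∑ j ∈ Finset.range n, (c j : ℂ) * u ^ (K + j) -
      ∑ j ∈ Finset.range n, (⌊d j⌋₊ : ℂ) * ρ ^ (K + j)‖ ≤ ‖ρ‖ ^ K * (1 - ‖ρ‖)⁻¹ := by
    rw [← Finset.sum_sub_distrib]
    calc _ ≤ ∑ j ∈ Finset.range n, ‖(c j : ℂ) * u ^ (K + j) - (⌊d j⌋₊ : ℂ) * ρ ^ (K + j)‖ :=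
          norm_sum_le _ _
      _ ≤ ∑ j ∈ Finset.range n, ‖ρ‖ ^ K * ‖ρ‖ ^ j := by
        refine Finset.sum_le_sum fun j _ => ?_
        have hcd : (c j : ℂ) * u ^ (K + j) = (d j : ℂ) * ρ ^ (K + j) := by
          have : ρ ^ (K + j) = (‖ρ‖ : ℂ) ^ (K + j) * u ^ (K + j) := by
            rw [← mul_pow, ← hρu]
          rw [this]
          simp only [d]
          push_cast
          field_simp
        rw [hcd, ← sub_mul, norm_mul, norm_pow, ← pow_add]
        refine mul_le_of_le_one_left (by positivity) ?_
        have : (d j : ℂ) - (⌊d j⌋₊ : ℂ) = ((d j - ⌊d j⌋₊ : ℝ) : ℂ) := by push_cast; rfl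
        rw [this, Complex.norm_real, Real.norm_of_nonneg (sub_nonneg.2 (Nat.floor_le (hd j)))]
        linarith [Nat.lt_floor_add_one (d j)]
      _ ≤ ‖ρ‖ ^ K * (1 - ‖ρ‖)⁻¹ := by
        rw [← Finset.mul_sum]
        gcongr
        rw [← tsum_geometric_of_lt_one hr0.le hρ]
        exact (summable_geometric_of_lt_one hr0.le hρ).sum_le_tsum _ fun _ _ => by positivity
  refine ⟨_, hcomb (K + n) m, ?_⟩
  rw [hsum, dist_eq_norm]
  rw [dist_eq_norm] at hn
  rw [hzw, ← sub_mul, norm_mul, ← lt_div_iff₀ hεn]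
  calc _ ≤ ‖w - ∑ j ∈ Finset.range n, (c j : ℂ) * u ^ (K + j)‖ +
        ‖∑ j ∈ Finset.range n, (c j : ℂ) * u ^ (K + j) -
          ∑ j ∈ Finset.range n, (⌊d j⌋₊ : ℂ) * ρ ^ (K + j)‖ := norm_sub_le_norm_sub_add_norm_sub ..
    _ < δ / ‖ε‖ / 2 + δ / ‖ε‖ / 2 := by
      rw [norm_sub_rev w]
      exact add_lt_add_of_lt_of_le hn (hfl.trans hK.le)
    _ = δ / ‖ε‖ := by ring

/-- The support is invariant under a continuous map whose push-forward is dominated. -/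
theorem MeasureTheory.Measure.map_mem_support {X : Type*} [TopologicalSpace X] [MeasurableSpace X]
    [BorelSpace X] {μ : Measure X} {f : X → X} (hf : Continuous f) {c : ℝ≥0∞} (hc : c ≠ 0)
    (hle : c • μ.map f ≤ μ) {x : X} (hx : x ∈ μ.support) : f x ∈ μ.support := by
  rw [Measure.mem_support_iff_forall] at hx ⊢
  intro U hU
  have h1 := hx _ (hf.continuousAt.preimage_mem_nhds hU)
  have h2 : μ (f ⁻¹' U) ≤ μ.map f U := Measure.le_map_apply hf.aemeasurable U
  refine lt_of_lt_of_le ?_ (hle U)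
  rw [Measure.smul_apply, smul_eq_mul]
  exact ENNReal.mul_pos hc (h1.trans_le h2).ne'

/-! ### Covers by images of words and the dimension bound -/

/-- The composition `f (w 0) ∘ ⋯ ∘ f (w (n - 1))` along a finite word. -/
def wordComp {ι E : Type*} (f : ι → E → E) : (n : ℕ) → (Fin n → ι) → E → E
  | 0, _ => id
  | n + 1, w => f (w 0) ∘ wordComp f n (Fin.tail w)

theorem sum_fin_succ_fun {ι M : Type*} [Fintype ι] [AddCommMonoid M] (n : ℕ)
    (g : (Fin (n + 1) → ι) → M) :
    ∑ w, g w = ∑ i, ∑ w : Fin n → ι, g (Fin.cons i w) := by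
  rw [← (Fin.consEquiv fun _ => ι).sum_comp, Fintype.sum_prod_type]
  rfl

theorem measure_eq_sum_wordComp {E : Type*} [MeasurableSpace E] {μ : Measure E}
    {f : Fin 2 → E → E} (hf : ∀ i, Measurable (f i))
    (h : ∀ B, MeasurableSet B → μ B = 2⁻¹ * ∑ i, μ (f i ⁻¹' B)) (n : ℕ) {B : Set E}
    (hB : MeasurableSet B) :
    μ B = 2⁻¹ ^ n * ∑ w : Fin n → Fin 2, μ (wordComp f n w ⁻¹' B) := by
  induction n generalizing B with
  | zero => simp [wordComp]
  | succ n ih =>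
    rw [h B hB, sum_fin_succ_fun, pow_succ', mul_assoc, Finset.mul_sum (a := 2⁻¹ ^ n)]
    congr 1
    refine Finset.sum_congr rfl fun i _ => ?_
    rw [ih (hf i hB)]
    rfl

/-- The number of symbols `0` minus the number of symbols `1` in a finite word. -/
def signCount {n : ℕ} (w : Fin n → Fin 2) : ℝ := 2 * ∑ i, (zeroIndicator (w i) : ℝ) - n

theorem signCount_cons {n : ℕ} (i : Fin 2) (w : Fin n → Fin 2) :
    signCount (Fin.cons i w : Fin (n + 1) → Fin 2) =
      signCount w + (2 * (zeroIndicator i : ℝ) - 1) := by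
  simp only [signCount, Fin.sum_univ_succ, Fin.cons_zero, Fin.cons_succ]
  push_cast
  ring

theorem sum_signCount (n : ℕ) : ∑ w : Fin n → Fin 2, signCount w = 0 := by
  induction n with
  | zero => simp [signCount]
  | succ n ih =>
    simp only [sum_fin_succ_fun, signCount_cons, Finset.sum_add_distrib, ih, Fin.sum_univ_two]
    simp [zeroIndicator]
    ring

/-- Variance of the simple random walk: each new letter adds 1 to the square, and the cross term
cancels by `sum_signCount`. -/
theorem sum_signCount_sq (n : ℕ) : ∑ w : Fin n → Fin 2, signCount w ^ 2 = 2 ^ n * n := by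
  induction n with
  | zero => simp [signCount]
  | succ n ih =>
    have hsq : ∀ (i : Fin 2) (w : Fin n → Fin 2), (signCount w + (2 * (zeroIndicator i : ℝ) - 1)) ^ 2
        = signCount w ^ 2 + (2 * (2 * (zeroIndicator i : ℝ) - 1)) * signCount w + 1 := by
      intro i w
      fin_cases i <;> simp [zeroIndicator] <;> ring
    simp only [sum_fin_succ_fun, signCount_cons, hsq, Finset.sum_add_distrib, ih, Fin.sum_univ_two,
      ← Finset.mul_sum, sum_signCount]
    simp
    ring

/-- Chebyshev's inequality for the number of words with few symbols `0`. -/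
theorem card_words_few_zeros_le {n : ℕ} (hn : 0 < n) {ε : ℝ} (hε : 0 < ε) :
    ((Finset.univ.filter fun w : Fin n → Fin 2 =>
      (∑ i, (zeroIndicator (w i) : ℝ)) < n * (1 / 2 - ε)).card : ℝ) ≤
      2 ^ n * (1 / (4 * ε ^ 2 * n)) := by
  have hn' : (0 : ℝ) < n := by exact_mod_cast hn
  set s := Finset.univ.filter fun w : Fin n → Fin 2 =>
      (∑ i, (zeroIndicator (w i) : ℝ)) < n * (1 / 2 - ε)
  have h1 : (s.card : ℝ) * (2 * ε * n) ^ 2 ≤ 2 ^ n * n := by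
    rw [← sum_signCount_sq, ← nsmul_eq_mul]
    refine (Finset.card_nsmul_le_sum s _ _ fun w hw => ?_).trans
      (Finset.sum_le_sum_of_subset_of_nonneg (Finset.subset_univ s) fun _ _ _ => sq_nonneg _)
    have hw' := (Finset.mem_filter.1 hw).2
    have : signCount w ≤ -(2 * ε * n) := by rw [signCount]; linarith
    have h0 : 0 ≤ 2 * ε * n := by positivity
    nlinarith
  rw [mul_one_div, le_div_iff₀ (by positivity)]
  refine le_of_mul_le_mul_right ?_ hn'
  linarith

theorem dist_wordComp {E : Type*} [PseudoMetricSpace E] {f : Fin 2 → E → E} {r : ℝ}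
    (hf : ∀ i x y, dist (f i x) (f i y) = r ^ zeroIndicator i * dist x y)
    (n : ℕ) (w : Fin n → Fin 2) (x y : E) :
    dist (wordComp f n w x) (wordComp f n w y) = r ^ (∑ i, zeroIndicator (w i)) * dist x y := by
  induction n with
  | zero => simp [wordComp]
  | succ n ih =>
    rw [wordComp, Function.comp_apply, Function.comp_apply, hf, ih, Fin.sum_univ_succ, pow_add,
      mul_assoc]
    rfl

section Dimension

variable {E : Type*} [NormedAddCommGroup E] [MeasurableSpace E] [BorelSpace E]

/-- The neighbourhood of radius `r ^ (n (1/2 - ε))` of the images of `0` under words of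
length `n`. -/
def wordCover (f : Fin 2 → E → E) (r ε : ℝ) (n : ℕ) : Set E :=
  ⋃ w : Fin n → Fin 2, Metric.closedBall (wordComp f n w 0) (r ^ (n * (1 / 2 - ε)))

theorem measurableSet_wordCover (f : Fin 2 → E → E) (r ε : ℝ) (n : ℕ) :
    MeasurableSet (wordCover f r ε n) :=
  MeasurableSet.iUnion fun _ => Metric.isClosed_closedBall.measurableSet

variable {f : Fin 2 → E → E} {r : ℝ}

/-- A point `x` of norm at most `r ^ (-nε)` is sent within `r ^ (n(1/2 - ε)) * r ^ (-nε)` of the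
image of 0 by any word with enough zeros; hence the loss `2ε`. The two error terms account for words
with few zeros and for distant `x`. -/
theorem measure_compl_wordCover_le {μ : Measure E} [IsProbabilityMeasure μ] (hr0 : 0 < r)
    (hr1 : r < 1) (hfm : ∀ i, Measurable (f i))
    (hf : ∀ i x y, dist (f i x) (f i y) = r ^ zeroIndicator i * dist x y)
    (h : ∀ B, MeasurableSet B → μ B = 2⁻¹ * ∑ i, μ (f i ⁻¹' B)) {ε : ℝ} (hε : 0 < ε) {n : ℕ}
    (hn : 0 < n) :
    μ (wordCover f r (2 * ε) n)ᶜ ≤ ENNReal.ofReal (1 / (4 * ε ^ 2 * n)) +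
      μ (Metric.closedBall 0 (r ^ (-(n * ε))))ᶜ := by
  set s := Finset.univ.filter fun w : Fin n → Fin 2 =>
      (∑ i, (zeroIndicator (w i) : ℝ)) < n * (1 / 2 - ε) with hs
  set b := μ (Metric.closedBall (0 : E) (r ^ (-(n * ε))))ᶜ with hb
  have hword : ∀ w : Fin n → Fin 2, μ (wordComp f n w ⁻¹' (wordCover f r (2 * ε) n)ᶜ) ≤
      (if w ∈ s then 1 else 0) + b := by
    intro w
    split_ifs with hw
    · exact prob_le_one.trans le_self_add
    · rw [zero_add]
      refine measure_mono fun x hx hxb => hx (Set.mem_iUnion.2 ⟨w, ?_⟩)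
      have hw' : n * (1 / 2 - ε) ≤ ((∑ i, zeroIndicator (w i) : ℕ) : ℝ) := by
        have := not_lt.1 fun hlt => hw (Finset.mem_filter.2 ⟨Finset.mem_univ w, hlt⟩)
        push_cast
        exact this
      rw [Metric.mem_closedBall, dist_wordComp hf]
      rw [Metric.mem_closedBall] at hxb
      calc _ ≤ r ^ (n * (1 / 2 - ε)) * r ^ (-(n * ε)) := by
            rw [← Real.rpow_natCast]
            exact mul_le_mul (Real.rpow_le_rpow_of_exponent_ge hr0 hr1.le hw') hxb dist_nonneg
              (by positivity)
        _ = r ^ (n * (1 / 2 - 2 * ε)) := by rw [← Real.rpow_add hr0]; congr 1; ring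
  have h2 : (2⁻¹ : ℝ≥0∞) ^ n * 2 ^ n = 1 := by
    rw [← mul_pow, ENNReal.inv_mul_cancel two_ne_zero ENNReal.ofNat_ne_top, one_pow]
  rw [measure_eq_sum_wordComp hfm h n (measurableSet_wordCover f r _ n).compl]
  calc _ ≤ 2⁻¹ ^ n * ∑ w : Fin n → Fin 2, ((if w ∈ s then 1 else 0) + b) := by
        gcongr with w; exact hword w
    _ = 2⁻¹ ^ n * s.card + b := by
      rw [Finset.sum_add_distrib, Finset.sum_const, Finset.sum_ite_mem, Finset.univ_inter,
        Finset.sum_const, Finset.card_univ, Fintype.card_fun, Fintype.card_fin, Fintype.card_fin,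
        mul_add, nsmul_eq_mul, nsmul_eq_mul, mul_one]
      push_cast
      rw [← mul_assoc, h2, one_mul]
    _ ≤ 2⁻¹ ^ n * ENNReal.ofReal (2 ^ n * (1 / (4 * ε ^ 2 * n))) + b := by
      gcongr
      rw [← ENNReal.ofReal_natCast]
      exact ENNReal.ofReal_le_ofReal (card_words_few_zeros_le hn hε)
    _ = _ := by
      rw [ENNReal.ofReal_mul (by positivity), ENNReal.ofReal_pow (by norm_num), ← mul_assoc]
      simp [h2]

theorem tendsto_measure_compl_wordCover {μ : Measure E} [IsProbabilityMeasure μ] (hr0 : 0 < r)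
    (hr1 : r < 1) (hfm : ∀ i, Measurable (f i))
    (hf : ∀ i x y, dist (f i x) (f i y) = r ^ zeroIndicator i * dist x y)
    (h : ∀ B, MeasurableSet B → μ B = 2⁻¹ * ∑ i, μ (f i ⁻¹' B)) {ε : ℝ} (hε : 0 < ε) :
    Tendsto (fun n => μ (wordCover f r (2 * ε) n)ᶜ) atTop (𝓝 0) := by
  have h1 : Tendsto (fun n : ℕ => ENNReal.ofReal (1 / (4 * ε ^ 2 * n))) atTop (𝓝 0) := by
    rw [← ENNReal.ofReal_zero]
    refine ENNReal.tendsto_ofReal (Tendsto.div_atTop tendsto_const_nhds ?_)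
    exact (tendsto_natCast_atTop_atTop (R := ℝ)).const_mul_atTop (by positivity)
  have hanti : Antitone fun n : ℕ => (Metric.closedBall (0 : E) (r ^ (-(n * ε))))ᶜ := by
    intro a b hab
    refine Set.compl_subset_compl.2 (Metric.closedBall_subset_closedBall ?_)
    refine Real.rpow_le_rpow_of_exponent_ge hr0 hr1.le (neg_le_neg ?_)
    gcongr
  have h2 : Tendsto (fun n : ℕ => μ (Metric.closedBall (0 : E) (r ^ (-(n * ε))))ᶜ) atTop
      (𝓝 0) := by
    have hlim := tendsto_measure_iInter_atTop (μ := μ)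
      (fun n => (Metric.isClosed_closedBall.measurableSet (α := E)).compl.nullMeasurableSet)
      hanti ⟨0, measure_ne_top _ _⟩
    have hempty : ⋂ n : ℕ, (Metric.closedBall (0 : E) (r ^ (-(n * ε))))ᶜ = ∅ := by
      refine Set.eq_empty_of_forall_notMem fun x hx => ?_
      have hpow : Tendsto (fun n : ℕ => r ^ (-(n * ε))) atTop atTop := by
        have h1 : 1 < r ^ (-ε) := Real.one_lt_rpow_of_pos_of_lt_one_of_neg hr0 hr1 (by linarith)
        refine (tendsto_pow_atTop_atTop_of_one_lt h1).congr fun n => ?_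
        rw [← Real.rpow_natCast, ← Real.rpow_mul hr0.le]
        congr 1; ring
      obtain ⟨n, hn⟩ := (hpow.eventually_ge_atTop ‖x‖).exists
      exact Set.mem_iInter.1 hx n (mem_closedBall_zero_iff.2 hn)
    rwa [hempty, measure_empty] at hlim
  refine tendsto_of_tendsto_of_tendsto_of_le_of_le' tendsto_const_nhds
    (by simpa only [add_zero] using h1.add h2) (Eventually.of_forall fun _ => zero_le) ?_
  filter_upwards [eventually_gt_atTop 0] with n hn
  exact measure_compl_wordCover_le hr0 hr1 hfm hf h hε hn

/-- The `2 ^ n` balls of a cover have `s`-sum at most `2 ^ s * (2 * r ^ ((1/2 - ε) s)) ^ n`, which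
tends to 0. -/
theorem hausdorffMeasure_iInter_wordCover (hr0 : 0 < r) (hr1 : r < 1) {ε s : ℝ} (hs : 0 ≤ s)
    (hε : ε < 1 / 2) (hθ : 2 * r ^ ((1 / 2 - ε) * s) < 1) {φ : ℕ → ℕ} (hφ : StrictMono φ)
    {F : Set E} {M : ℕ} (hF : ∀ k, M ≤ k → F ⊆ wordCover f r ε (φ k)) :
    Measure.hausdorffMeasure s F = 0 := by
  have hrad : Tendsto (fun n : ℕ => r ^ (n * (1 / 2 - ε))) atTop (𝓝 0) := by
    have h1 : r ^ (1 / 2 - ε) < 1 := Real.rpow_lt_one hr0.le hr1 (by linarith)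
    refine (tendsto_pow_atTop_nhds_zero_of_lt_one (by positivity) h1).congr fun n => ?_
    rw [← Real.rpow_natCast, ← Real.rpow_mul hr0.le, mul_comm]
  have hdiam : ∀ (x : E) (n : ℕ), Metric.ediam (Metric.closedBall x (r ^ (n * (1 / 2 - ε)))) ≤
      ENNReal.ofReal (2 * r ^ (n * (1 / 2 - ε))) := by
    intro x n
    rw [← Metric.closedEBall_ofReal (by positivity)]
    refine Metric.ediam_closedEBall_le.trans ?_
    rw [ENNReal.ofReal_mul (by norm_num)]
    simp
  have hle := Measure.hausdorffMeasure_le_liminf_sum s F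
    (l := atTop) (ι := fun k : ℕ => Fin (φ k) → Fin 2)
    (fun k => ENNReal.ofReal (2 * r ^ (φ k * (1 / 2 - ε))))
    (by
      rw [← ENNReal.ofReal_zero]
      refine ENNReal.tendsto_ofReal ?_
      simpa using (hrad.comp hφ.tendsto_atTop).const_mul 2)
    (fun k w => Metric.closedBall (wordComp f (φ k) w 0) (r ^ (φ k * (1 / 2 - ε))))
    (Eventually.of_forall fun k w => hdiam _ _)
    ((eventually_ge_atTop M).mono fun k hk => hF k hk)
  refine le_antisymm (hle.trans ?_) zero_le
  have hbound : Tendsto (fun k => ENNReal.ofReal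
      (2 ^ s * (2 * r ^ ((1 / 2 - ε) * s)) ^ φ k)) atTop (𝓝 0) := by
    rw [← ENNReal.ofReal_zero]
    refine ENNReal.tendsto_ofReal ?_
    simpa using ((tendsto_pow_atTop_nhds_zero_of_lt_one (by positivity) hθ).comp
      hφ.tendsto_atTop).const_mul (2 ^ s)
  rw [← hbound.liminf_eq]
  refine liminf_le_liminf (Eventually.of_forall fun k => ?_)
  calc _ ≤ ∑ _w : Fin (φ k) → Fin 2, ENNReal.ofReal (2 * r ^ (φ k * (1 / 2 - ε))) ^ s :=
        Finset.sum_le_sum fun w _ => ENNReal.rpow_le_rpow (hdiam _ _) hs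
    _ = _ := by
      rw [Finset.sum_const, Finset.card_univ, Fintype.card_fun, Fintype.card_fin,
        Fintype.card_fin, nsmul_eq_mul, ENNReal.ofReal_rpow_of_nonneg (by positivity) hs,
        ← ENNReal.ofReal_natCast, ← ENNReal.ofReal_mul (by positivity)]
      congr 1
      rw [Real.mul_rpow (by norm_num) (by positivity), mul_pow, ← Real.rpow_mul hr0.le,
        ← Real.rpow_natCast (r ^ _), ← Real.rpow_mul hr0.le]
      push_cast
      ring_nf

/-- A measure stationary for a fair random choice of a similarity of ratio `r` and an isometry is
carried by measurable sets of every dimension larger than `2 log 2 / log (1 / r)`. -/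
theorem exists_measurableSet_dimH_le {μ : Measure E} [IsProbabilityMeasure μ] (hr0 : 0 < r)
    (hr1 : r < 1) (hfm : ∀ i, Measurable (f i))
    (hf : ∀ i x y, dist (f i x) (f i y) = r ^ zeroIndicator i * dist x y)
    (h : ∀ B, MeasurableSet B → μ B = 2⁻¹ * ∑ i, μ (f i ⁻¹' B)) {s : ℝ≥0}
    (hs : 2 * Real.log 2 / -Real.log r < s) :
    ∃ S, MeasurableSet S ∧ μ Sᶜ = 0 ∧ dimH S ≤ s := by
  have hlog : Real.log r < 0 := Real.log_neg hr0 hr1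
  have hs0 : (0 : ℝ) < s := lt_of_le_of_lt
    (div_nonneg (by have := Real.log_pos one_lt_two; linarith) (by linarith)) hs
  -- At `ε = 0` the last inequality is the assumption on `s`; continuity gives it for small positive
  -- `ε`.
  obtain ⟨ε, hε0, hε1, hε⟩ : ∃ ε : ℝ, 0 < ε ∧ 2 * ε < 1 / 2 ∧
      2 * r ^ ((1 / 2 - 2 * ε) * s) < 1 := by
    have hcont : Continuous fun ε : ℝ => 2 * r ^ ((1 / 2 - 2 * ε) * s) := by
      refine continuous_const.mul (Continuous.rpow continuous_const (by fun_prop) fun _ =>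
        Or.inl hr0.ne')
    have h0 : 2 * r ^ ((1 / 2 - 2 * (0 : ℝ)) * s) < 1 := by
      rw [div_lt_iff₀ (by linarith)] at hs
      rw [Real.rpow_def_of_pos hr0]
      nth_rw 1 [← Real.exp_log two_pos]
      rw [← Real.exp_add, Real.exp_lt_one_iff]
      nlinarith
    have hev := (hcont.tendsto 0).eventually_lt_const h0
    have hev2 : ∀ᶠ ε in 𝓝 (0 : ℝ), 2 * ε < 1 / 2 := by
      refine (continuous_const.mul continuous_id).tendsto (0 : ℝ) |>.eventually_lt_const ?_
      norm_num
    obtain ⟨ε, ⟨h1, h2⟩, h3⟩ := (((hev.and hev2).filter_mono nhdsWithin_le_nhds).and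
      (self_mem_nhdsWithin (s := Set.Ioi (0 : ℝ)))).exists
    exact ⟨ε, h3, h2, h1⟩
  have htend := tendsto_measure_compl_wordCover hr0 hr1 hfm hf h hε0
  -- The available error bound is not summable in `n`, so Borel–Cantelli is applied along a sparse
  -- subsequence.
  obtain ⟨φ, hφ, hφle⟩ : ∃ φ : ℕ → ℕ, StrictMono φ ∧
      ∀ k, μ (wordCover f r (2 * ε) (φ k))ᶜ ≤ 2⁻¹ ^ k := by
    refine extraction_forall_of_eventually' (P := fun k n =>
      μ (wordCover f r (2 * ε) n)ᶜ ≤ 2⁻¹ ^ k) fun k => ?_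
    have hpos : (0 : ℝ≥0∞) < 2⁻¹ ^ k := ENNReal.pow_pos (by simp) k
    obtain ⟨N, hN⟩ := eventually_atTop.1 (htend.eventually_le_const hpos)
    exact ⟨N, hN⟩
  -- The points eventually in every cover; by countable stability of `dimH`, each `M` may be treated
  -- separately.
  refine ⟨⋃ M, ⋂ k ≥ M, wordCover f r (2 * ε) (φ k), ?_, ?_, ?_⟩
  · exact .iUnion fun M => .iInter fun k => .iInter fun _ => measurableSet_wordCover _ _ _ _
  · have hsum : ∑' k, μ (wordCover f r (2 * ε) (φ k))ᶜ ≠ ∞ := by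
      refine ne_top_of_le_ne_top ?_ (ENNReal.tsum_le_tsum hφle)
      rw [ENNReal.tsum_geometric, ENNReal.one_sub_inv_two, inv_inv]
      exact ENNReal.ofNat_ne_top
    have hae := ae_eventually_notMem hsum
    refine measure_mono_null (fun x hx => ?_) (ae_iff.1 hae)
    refine fun hx' => hx ?_
    obtain ⟨M, hM⟩ := eventually_atTop.1 hx'
    exact Set.mem_iUnion.2 ⟨M, Set.mem_iInter₂.2 fun k hk => not_not.1 (hM k hk)⟩
  · rw [dimH_iUnion]
    refine iSup_le fun M => dimH_le_of_hausdorffMeasure_ne_top ?_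
    rw [hausdorffMeasure_iInter_wordCover hr0 hr1 s.coe_nonneg hε1 hε hφ (M := M)
      (F := ⋂ k ≥ M, wordCover f r (2 * ε) (φ k)) fun k hk => Set.iInter₂_subset k hk]
    exact ENNReal.zero_ne_top

end Dimension

/-! ### Application to the planar system -/

section PlanarIFS

/-- The linear contraction of the planar system. -/
noncomputable def planarContraction (α lam : ℝ) :
    EuclideanSpace ℝ (Fin 2) →L[ℝ] EuclideanSpace ℝ (Fin 2) :=
  LinearMap.toContinuousLinearMap (Matrix.toEuclideanLin (lam • rotMatrix α)⁻¹)

variable {α lam : ℝ} {e : EuclideanSpace ℝ (Fin 2)}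

theorem norm_planarContraction (hlam : 0 < lam) (x : EuclideanSpace ℝ (Fin 2)) :
    ‖planarContraction α lam x‖ = lam⁻¹ * ‖x‖ :=
  norm_toEuclideanLin_smul_rotMatrix_inv α lam hlam x

theorem isStationaryMeasure_planarIFS_iff {μ : Measure (EuclideanSpace ℝ (Fin 2))} :
    IsStationaryMeasure (planarIFS α lam e) (PMF.uniformOfFintype (Fin 2)) μ ↔
      IsProbabilityMeasure μ ∧ markovOp (planarContraction α lam) e μ = μ := by
  rw [IsStationaryMeasure, Fin.sum_univ_two, PMF.uniformOfFintype_apply,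
    PMF.uniformOfFintype_apply, Fintype.card_fin]
  rfl

theorem continuous_planarIFS (i : Fin 2) : Continuous (planarIFS α lam e i) := by
  fin_cases i
  · exact (planarContraction α lam).continuous
  · exact continuous_add_const e

theorem dist_planarIFS (hlam : 0 < lam) (i : Fin 2) (x y : EuclideanSpace ℝ (Fin 2)) :
    dist (planarIFS α lam e i x) (planarIFS α lam e i y) =
      lam⁻¹ ^ zeroIndicator i * dist x y := by
  fin_cases i
  · change dist (planarContraction α lam x) (planarContraction α lam y) = lam⁻¹ ^ 1 * dist x y
    rw [dist_eq_norm, ← map_sub, norm_planarContraction hlam, pow_one, dist_eq_norm]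
  · change dist (x + e) (y + e) = lam⁻¹ ^ 0 * dist x y
    simp

variable {μ : Measure (EuclideanSpace ℝ (Fin 2))}

theorem IsStationaryMeasure.apply_planarIFS
    (h : IsStationaryMeasure (planarIFS α lam e) (PMF.uniformOfFintype (Fin 2)) μ)
    {B : Set (EuclideanSpace ℝ (Fin 2))} (hB : MeasurableSet B) :
    μ B = 2⁻¹ * ∑ i, μ (planarIFS α lam e i ⁻¹' B) := by
  conv_lhs => rw [← h.2]
  rw [Measure.finsetSum_apply, Finset.mul_sum]
  refine Finset.sum_congr rfl fun i _ => ?_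
  rw [Measure.smul_apply, Measure.map_apply (continuous_planarIFS i).measurable hB,
    PMF.uniformOfFintype_apply, Fintype.card_fin]
  rfl

theorem IsStationaryMeasure.support_planarIFS (hα : Irrational (α / Real.pi)) (he : e ≠ 0)
    (hlam : 1 < lam)
    (h : IsStationaryMeasure (planarIFS α lam e) (PMF.uniformOfFintype (Fin 2)) μ) :
    μ.support = Set.univ := by
  have hprob := h.1
  have hlam0 : 0 < lam := by linarith
  have hinv : ∀ i, ∀ x ∈ μ.support, planarIFS α lam e i x ∈ μ.support := by
    intro i x hx
    refine Measure.map_mem_support (c := 2⁻¹) (continuous_planarIFS i) (by simp) ?_ hx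
    refine Measure.le_iff.2 fun B hB => ?_
    rw [h.apply_planarIFS hB, Measure.smul_apply, smul_eq_mul,
      Measure.map_apply (continuous_planarIFS i).measurable hB]
    gcongr
    exact Finset.single_le_sum (f := fun i => μ (planarIFS α lam e i ⁻¹' B))
      (fun _ _ => zero_le) (Finset.mem_univ i)
  let ψ := Complex.orthonormalBasisOneI.repr
  have hT : ψ ⁻¹' μ.support = Set.univ := by
    refine IsClosed.eq_univ_of_mul_mem_of_add_mem
      (ρ := (lam : ℂ)⁻¹ * Complex.exp (-(α * Complex.I))) (ε := ψ.symm e)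
      (Measure.isClosed_support.preimage ψ.continuous)
      ((Measure.nonempty_support (IsProbabilityMeasure.ne_zero μ)).preimage ψ.surjective) ?_
      (im_inv_mul_exp_neg_ne_zero α lam hα hlam0.ne') (by simpa using he) ?_ ?_
    · have := norm_toEuclideanLin_smul_rotMatrix_inv α lam hlam0 (ψ 1)
      rw [toEuclideanLin_smul_rotMatrix_inv α lam hlam0.ne', LinearIsometryEquiv.norm_map,
        LinearIsometryEquiv.norm_map, mul_one, norm_one, mul_one] at this
      rw [this]
      exact inv_lt_one_of_one_lt₀ hlam
    · intro z hz
      have := hinv 0 _ hz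
      change Matrix.toEuclideanLin (lam • rotMatrix α)⁻¹ (ψ z) ∈ μ.support at this
      rwa [toEuclideanLin_smul_rotMatrix_inv α lam hlam0.ne'] at this
    · intro z hz
      have := hinv 1 _ hz
      change ψ z + e ∈ μ.support at this
      change ψ (z + ψ.symm e) ∈ μ.support
      rwa [map_add, ψ.apply_symm_apply]
  rw [← Set.image_preimage_eq μ.support ψ.surjective, hT, Set.image_univ, ψ.surjective.range_eq]

theorem IsStationaryMeasure.exists_measurableSet_dimH_le (hlam : 1 < lam)
    (h : IsStationaryMeasure (planarIFS α lam e) (PMF.uniformOfFintype (Fin 2)) μ) {s : ℝ≥0}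
    (hs : 2 * Real.log 2 / Real.log lam < s) :
    ∃ S, MeasurableSet S ∧ μ Sᶜ = 0 ∧ dimH S ≤ s := by
  have hprob := h.1
  have hlam0 : 0 < lam := by linarith
  refine _root_.exists_measurableSet_dimH_le (r := lam⁻¹) (inv_pos.2 hlam0)
    (inv_lt_one_of_one_lt₀ hlam) (fun i => (continuous_planarIFS i).measurable)
    (dist_planarIFS (α := α) (e := e) hlam0) (fun B hB => h.apply_planarIFS hB) ?_
  rwa [Real.log_inv, neg_neg]

end PlanarIFS

/-- A measure carried by a set of Hausdorff dimension less than `2` is singular in the plane. -/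
theorem mutuallySingular_volume_of_dimH_lt {μ : Measure (EuclideanSpace ℝ (Fin 2))}
    {S : Set (EuclideanSpace ℝ (Fin 2))} (hS : MeasurableSet S) (hμ : μ Sᶜ = 0)
    (hdim : dimH S < 2) : μ ⟂ₘ volume := by
  have hac : (volume : Measure (EuclideanSpace ℝ (Fin 2))) ≪
      Measure.hausdorffMeasure ((2 : ℝ≥0) : ℝ) := by
    have h := isAddHaarMeasure_hausdorffMeasure (E := EuclideanSpace ℝ (Fin 2))
    rw [finrank_euclideanSpace_fin] at h
    have h2 : ((2 : ℝ≥0) : ℝ) = ((2 : ℕ) : ℝ) := by norm_num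
    rw [h2]
    exact Measure.absolutelyContinuous_isAddHaarMeasure _ _
  refine ⟨Sᶜ, hS.compl, hμ, ?_⟩
  rw [compl_compl]
  exact measure_zero_of_dimH_lt hac (by exact_mod_cast hdim)

theorem mainTheorem6 (α : ℝ) (hα : Irrational (α / Real.pi))
    (e : EuclideanSpace ℝ (Fin 2)) (he : ‖e‖ = 1) (lam : ℝ) (hlam : 1 < lam) :
    ContractsOnAverage (planarIFS α lam e) (PMF.uniformOfFintype (Fin 2)) ∧
    (∃! μ : Measure (EuclideanSpace ℝ (Fin 2)),
      IsStationaryMeasure (planarIFS α lam e) (PMF.uniformOfFintype (Fin 2)) μ) ∧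
    ∀ μ : Measure (EuclideanSpace ℝ (Fin 2)),
      IsStationaryMeasure (planarIFS α lam e) (PMF.uniformOfFintype (Fin 2)) μ →
        μ.support = Set.univ ∧
        (2 < lam →
          μ ⟂ₘ volume ∧
          measureDimH μ ≤ ENNReal.ofReal (2 * Real.log 2 / Real.log lam) ∧
          2 * Real.log 2 / Real.log lam < 2) := by
  have hlam0 : 0 < lam := by linarith
  have hr1 : lam⁻¹ < 1 := inv_lt_one_of_one_lt₀ hlam
  have hr0 : 0 < lam⁻¹ := inv_pos.2 hlam0
  have he0 : e ≠ 0 := by rintro rfl; simp at he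
  have hA : ∀ x, ‖planarContraction α lam x‖ ≤ lam⁻¹ * ‖x‖ := fun x =>
    (norm_planarContraction hlam0 x).le
  refine ⟨?_, ?_, fun μ hμ => ⟨hμ.support_planarIFS hα he0 hlam, fun hlam2 => ?_⟩⟩
  · exact contractsOnAverage_of_dist_eq (r := ⟨lam⁻¹, hr0.le⟩) hr0 hr1 (dist_planarIFS hlam0)
  · obtain ⟨μ, hμ, hfix⟩ := exists_markovOp_fixedPoint hA hr0.le hr1 e
    refine ⟨μ, isStationaryMeasure_planarIFS_iff.2 ⟨hμ, hfix⟩, fun ν hν => ?_⟩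
    obtain ⟨hν1, hν2⟩ := isStationaryMeasure_planarIFS_iff.1 hν
    exact markovOp_fixedPoint_unique hA hr0.le hr1 e hν2 hfix
  · have hlog : 0 < Real.log lam := Real.log_pos hlam
    have hlt : 2 * Real.log 2 / Real.log lam < 2 := by
      rw [div_lt_iff₀ hlog]
      have := Real.log_lt_log two_pos hlam2
      linarith
    refine ⟨?_, ?_, hlt⟩
    · obtain ⟨s, hs1, hs2⟩ := exists_between hlt
      have hs0 : 0 ≤ s := le_trans (by have := Real.log_pos one_lt_two; positivity) hs1.le
      obtain ⟨S, hS, hμS, hdim⟩ := hμ.exists_measurableSet_dimH_le hlam (s := ⟨s, hs0⟩) hs1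
      exact mutuallySingular_volume_of_dimH_lt hS hμS
        (hdim.trans_lt ((ENNReal.coe_lt_coe.2 (show (⟨s, hs0⟩ : ℝ≥0) < 2 from hs2)).trans_eq
          (ENNReal.coe_ofNat 2)))
    · refine ENNReal.le_of_forall_pos_le_add fun δ hδ _ => ?_
      obtain ⟨S, hS, hμS, hdim⟩ := hμ.exists_measurableSet_dimH_le hlam
        (s := (2 * Real.log 2 / Real.log lam).toNNReal + δ)
        ((Real.le_coe_toNNReal _).trans_lt (by exact_mod_cast lt_add_of_pos_right _ hδ))
      exact (iInf_le_of_le S (iInf₂_le hS hμS)).trans (hdim.trans (by push_cast; rfl))
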